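/- Let $R$ be an associative ring with identity; all modules are unital $R$-modules on one fixed side. A submodule $N$ of $M$ is small in $M$ if $X+N\neq M$ for every proper submodule $X$ of $M$. A projective cover of $M$ is an epimorphism $\sigma:P\to M$ with $P$ projective and $\ker\sigma$ small in $P$. $M$ is semiperfect if each of its homomorphic images has a projective cover. A complement of a submodule $S$ of $M$ is a submodule of $M$ maximal with respect to having zero intersection with $S$; $M$ is ADS if for every decomposition $M=S\oplus T$ and every complement $T'$ of $S$ in $M$ one has $M=S\oplus T'$; $M$ is completely ADS if every subfactor $N/K$ ($K\subseteq N\subseteq M$) is ADS. A module is local if it has a largest proper submodule (so it is nonzero). A supplement of a submodule $A$ of $M$ is a submodule $X$ of $M$ minimal with respect to $A+X=M$. Theorem. Let $M$ be a semiperfect module with a projective cover $\sigma:P\to M$ such that $P$ is completely ADS. Then there are submodules $S$, $T$ and $L_i$ $(i\in I)$ of $M$ such that $M=S\oplus T$, the module $S$ is semisimple, $T=\bigoplus_{i\in I}L_i$, and every $L_i$ is local. Moreover, every partial sum of the decomposition $M=S\oplus\bigoplus_{i\in I}L_i$ contains a supplement of the sum of the remaining terms: for each subset $A$ of the set of terms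 (the submodule $S$ and the submodules $L_i$), the sum of the terms in $A$ contains a supplement in $M$ of the sum of the terms not in $A$. -/

import Mathlib

universe u v w

namespace ADSModule



section Submodules

variable {R : Type u} [Ring R] {M : Type v} [AddCommGroup M] [Module R M]

/-- `N` is small in `M`: for any proper submodule `P` of `M`, `P + N ≠ M`. -/
def IsSmallSubmodule (N : Submodule R M) : Prop :=
  ∀ P : Submodule R M, P ≠ ⊤ → P ⊔ N ≠ ⊤

/-- `T` is a complement of `S` in `M`, in the sense of module theory: `T` is maximal among the
submodules having zero intersection with `S`. (This is weaker than `M = S ⊕ T`.) -/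
def IsComplementOf (T S : Submodule R M) : Prop :=
  Maximal (fun X : Submodule R M => S ⊓ X = ⊥) T

/-- `X` is a supplement of `A` in `M`: `X` is minimal with the property `A + X = M`. -/
def IsSupplementOf (X A : Submodule R M) : Prop :=
  Minimal (fun Y : Submodule R M => A ⊔ Y = ⊤) X

end Submodules

section Modules

variable (R : Type u) [Ring R] (M : Type v) [AddCommGroup M] [Module R M]

/-- `M` is ADS: for every decomposition `M = S ⊕ T` and every complement `T'` of `S` in `M`,
also `M = S ⊕ T'`. -/
def IsADS : Prop :=
  ∀ S T T' : Submodule R M, IsCompl S T → IsComplementOf T' S → IsCompl S T'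

/-- `M` is completely ADS: each subfactor `N / K`, with `K ≤ N ≤ M`, is ADS. -/
def IsCompletelyADS : Prop :=
  ∀ (N : Submodule R M) (K : Submodule R N), IsADS R (N ⧸ K)

/-- `M` is a local module: it has a largest proper submodule. In particular `M` is nonzero. -/
def IsLocalModule : Prop :=
  ∃ N : Submodule R M, N ≠ ⊤ ∧ ∀ N' : Submodule R M, N' ≠ ⊤ → N' ≤ N

end Modules

/-- `σ : P → M` is a projective cover of `M`: `P` is projective and `σ` is an epimorphism whose
kernel is small in `P`. -/
structure IsProjectiveCover {R : Type u} [Ring R] {P : Type w} [AddCommGroup P] [Module R P]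
    {M : Type v} [AddCommGroup M] [Module R M] (σ : P →ₗ[R] M) : Prop where
  projective : Module.Projective R P
  surjective : Function.Surjective σ
  small_ker : IsSmallSubmodule (LinearMap.ker σ)

/-- `M` is semiperfect: each homomorphic image `M / N` has a projective cover. A projective
cover of a module `X` is isomorphic to a quotient of the free module `R^(X)`, so it exists in
some universe if and only if it exists in the one used here. -/
def IsSemiperfectModule (R : Type u) [Ring R] (M : Type v) [AddCommGroup M] [Module R M] : Prop :=
  ∀ N : Submodule R M, ∃ (P : Type (max u v)) (_ : AddCommGroup P) (_ : Module R P)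
    (π : P →ₗ[R] (M ⧸ N)), IsProjectiveCover π

/-- The terms of a decomposition `M = S ⊕ ⨁ i, L i`: the term `none` is `S` and the term
`some i` is `L i`. -/
def terms {R : Type u} [Ring R] {M : Type v} [AddCommGroup M] [Module R M] {ι : Type w}
    (S : Submodule R M) (L : ι → Submodule R M) : Option ι → Submodule R M
  | none => S
  | some i => L i

end ADSModule

namespace ADSModule

/-! ### Small submodules and the radical of a projective module -/

section Small

variable {R : Type u} [Ring R] {M : Type v} [AddCommGroup M] [Module R M]
  {N : Type w} [AddCommGroup N] [Module R N]

/-! The work takes place in `P`. Let `K` be the kernel of `σ` and `J` the radical of `P`. Lifting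
projective covers of quotients of `M` shows that `J` is small and `P / J` semisimple; its simple
summands lift to local direct summands `B i` with `P = ⨁ B i` (`exists_iSupIndep_isLocalModule`).

The ADS hypothesis forces `K` to respect this decomposition: the `B i`-component of an element of
`K` lies in `K` (`IsCompletelyADS.mem_of_add_mem`). Hence `M` is the direct sum of the local modules
`σ (B i)`. The simple ones are collected into `S`, and a partial sum, being a direct complement of
the rest, is itself a supplement. -/

theorem IsSmallSubmodule.eq_top {K X : Submodule R M} (hK : IsSmallSubmodule K)
    (h : X ⊔ K = ⊤) : X = ⊤ :=
  not_not.mp fun hX => hK X hX h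

theorem IsSmallSubmodule.mono {K L : Submodule R M} (hL : IsSmallSubmodule L) (h : K ≤ L) :
    IsSmallSubmodule K :=
  fun X hX hXK => hL X hX (top_le_iff.mp (hXK ▸ sup_le_sup_left h X))

theorem IsSmallSubmodule.map {K : Submodule R M} (hK : IsSmallSubmodule K) (f : M →ₗ[R] N) :
    IsSmallSubmodule (K.map f) := by
  intro X hX hXK
  have h : X.comap f = ⊤ := by
    apply hK.eq_top
    rw [eq_top_iff]
    intro y _
    obtain ⟨x, hx, z, ⟨k, hk, rfl⟩, hxz⟩ :=
      Submodule.mem_sup.mp (hXK ▸ Submodule.mem_top : f y ∈ X ⊔ K.map f)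
    refine Submodule.mem_sup.mpr ⟨y - k, ?_, k, hk, by simp⟩
    rw [Submodule.mem_comap, map_sub, ← hxz, add_sub_cancel_right]
    exact hx
  apply hX
  rw [sup_of_le_left] at hXK
  · exact hXK
  · rintro _ ⟨k, -, rfl⟩
    exact (h ▸ Submodule.mem_top : k ∈ X.comap f)

theorem IsSmallSubmodule.le_jacobson {K : Submodule R M} (hK : IsSmallSubmodule K) :
    K ≤ Module.jacobson R M := by
  refine le_sInf fun m hm => ?_
  by_contra h
  exact hK m hm.1 (hm.2 _ (left_lt_sup.mpr h))

theorem isSmallSubmodule_jacobson_of_finite [Module.Finite R M] :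
    IsSmallSubmodule (Module.jacobson R M) := by
  intro X hX h
  obtain ⟨m, hm, hXm⟩ := (eq_top_or_exists_le_coatom X).resolve_left hX
  exact hm.1 (top_le_iff.mp (h ▸ sup_le hXm (sInf_le hm)))

/-- Nakayama: `1 - e` is onto because the radical is small, so it splits. Its kernel lies in the
small range of `e`, so the section is onto as well and `1 - e` is injective. -/
theorem eq_zero_of_apply_eq_self_of_finite [Module.Finite R M] [Module.Projective R M]
    (e : M →ₗ[R] M) (he : LinearMap.range e ≤ Module.jacobson R M) {x : M} (hx : e x = x) :
    x = 0 := by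
  set f : M →ₗ[R] M := LinearMap.id - e with hf
  have hsmall := (isSmallSubmodule_jacobson_of_finite (R := R) (M := M)).mono he
  have hfr : LinearMap.range f = ⊤ := by
    apply hsmall.eq_top
    rw [eq_top_iff]
    intro y _
    exact Submodule.mem_sup.mpr ⟨f y, ⟨y, rfl⟩, e y, ⟨y, rfl⟩, by simp [hf]⟩
  obtain ⟨h, hh⟩ := f.exists_rightInverse_of_surjective hfr
  have hfh : ∀ y, f (h y) = y := fun y => LinearMap.congr_fun hh y
  have hhr : LinearMap.range h = ⊤ := by
    apply hsmall.eq_top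
    rw [eq_top_iff]
    intro y _
    refine Submodule.mem_sup.mpr ⟨h (f y), ⟨_, rfl⟩, y - h (f y), ⟨y - h (f y), ?_⟩, by simp⟩
    have : f (y - h (f y)) = 0 := by rw [map_sub, hfh, sub_self]
    rw [hf, LinearMap.sub_apply, LinearMap.id_apply, sub_eq_zero] at this
    exact this.symm
  obtain ⟨y, rfl⟩ := (hhr ▸ Submodule.mem_top : x ∈ LinearMap.range h)
  have : f (h y) = 0 := by rw [hf, LinearMap.sub_apply, hx, LinearMap.id_apply, sub_self]
  rw [hfh] at this
  rw [this, map_zero]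

/-- An endomorphism of a projective module with image in the radical has no nonzero fixed
points. -/
theorem eq_zero_of_apply_eq_self [Module.Projective R M] (e : M →ₗ[R] M)
    (he : LinearMap.range e ≤ Module.jacobson R M) {x : M} (hx : e x = x) : x = 0 := by
  obtain ⟨s, hs⟩ := Module.projective_def'.mp ‹Module.Projective R M›
  set q := Finsupp.linearCombination R (id : M → M)
  have hqs : ∀ y, q (s y) = y := fun y => LinearMap.congr_fun hs y
  -- Reduction to a finite free module: the span of the basis elements occurring in `s x` has the
  -- endomorphism `p ∘ s ∘ e ∘ q ∘ j`, which fixes `p (s x)`.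
  let t : Set M := ↑(s x).support
  let E := Finsupp.supportedEquivFinsupp (M := R) (R := R) t
  have : Finite t := (s x).support.finite_toSet
  have : Module.Finite R (Finsupp.supported R R t) := Module.Finite.equiv E.symm
  have : Module.Projective R (Finsupp.supported R R t) := Module.Projective.of_equiv E.symm
  classical
  let p := Finsupp.restrictDom R R t
  let j := (Finsupp.supported R R t).subtype
  have hjp : j (p (s x)) = s x := by
    simp only [j, p, Submodule.subtype_apply, Finsupp.restrictDom_apply]
    rw [Finsupp.filter_eq_self_iff]
    intro a ha
    exact Finsupp.mem_support_iff.mpr ha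
  have hg : LinearMap.range ((p ∘ₗ s) ∘ₗ e ∘ₗ (q ∘ₗ j)) ≤
      Module.jacobson R (Finsupp.supported R R t) := by
    rintro _ ⟨y, rfl⟩
    exact Module.map_jacobson_le (p ∘ₗ s) ⟨_, he ⟨(q ∘ₗ j) y, rfl⟩, rfl⟩
  have h0 := eq_zero_of_apply_eq_self_of_finite _ hg (x := p (s x)) (by
    simp only [LinearMap.comp_apply, hjp, hqs, hx])
  rw [← hqs x, ← hjp, h0, map_zero, map_zero]

end Small

/-! ### Lifting direct summands along a projective cover -/

section Projective

variable {R : Type u} [Ring R] {M : Type v} [AddCommGroup M] [Module R M]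
  {P : Type w} [AddCommGroup P] [Module R P]

/-- Submodules above the kernel of a projective cover of a semiperfect module can be approximated
from below by direct summands. -/
theorem exists_isCompl_le_of_ker_le (hM : IsSemiperfectModule R M) {σ : P →ₗ[R] M}
    (hσ : IsProjectiveCover σ) {A : Submodule R P} (hA : LinearMap.ker σ ≤ A) :
    ∃ B Q : Submodule R P, IsCompl B Q ∧ B ≤ A ∧ IsSmallSubmodule (A ⊓ Q) := by
  obtain ⟨P', _, _, π, hπ⟩ := hM (A.map σ)
  have := hσ.projective
  have := hπ.projective
  set τ := (A.map σ).mkQ ∘ₗ σ with hτ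
  have hτA : LinearMap.ker τ = A := by
    rw [hτ, LinearMap.ker_comp, Submodule.ker_mkQ, Submodule.comap_map_eq_self hA]
  have hτs : Function.Surjective τ := (Submodule.mkQ_surjective _).comp hσ.surjective
  -- The lift `g` is onto since `ker π` is small, hence splits. Its kernel serves as `B`, and `A ⊓
  -- range h` lies in the small submodule `h (ker π)`.
  obtain ⟨g, hg⟩ := Module.projective_lifting_property π τ hπ.surjective
  have hg' : ∀ y, π (g y) = τ y := fun y => LinearMap.congr_fun hg y
  have hgr : LinearMap.range g = ⊤ := by
    apply hπ.small_ker.eq_top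
    rw [eq_top_iff]
    intro y _
    obtain ⟨z, hz⟩ := hτs (π y)
    exact Submodule.mem_sup.mpr ⟨g z, ⟨z, rfl⟩, y - g z, by simp [hg', hz], by simp⟩
  obtain ⟨h, hh⟩ := g.exists_rightInverse_of_surjective hgr
  have hgh : ∀ y, g (h y) = y := fun y => LinearMap.congr_fun hh y
  have hc : IsCompl (LinearMap.ker g) (LinearMap.range h) := by
    refine ⟨Submodule.disjoint_def.mpr ?_, codisjoint_iff.mpr (eq_top_iff.mpr fun y _ => ?_)⟩
    · rintro _ hy ⟨z, rfl⟩
      rw [← hgh z, LinearMap.mem_ker.mp hy, map_zero]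
    · exact Submodule.mem_sup.mpr ⟨y - h (g y), by simp [hgh], h (g y), ⟨_, rfl⟩, by simp⟩
  refine ⟨LinearMap.ker g, LinearMap.range h, hc, ?_, ?_⟩
  · intro y hy
    rw [← hτA, LinearMap.mem_ker, ← hg', LinearMap.mem_ker.mp hy, map_zero]
  · refine (hπ.small_ker.map h).mono ?_
    rintro _ ⟨hy, z, rfl⟩
    refine ⟨z, ?_, rfl⟩
    rw [← hτA] at hy
    have : τ (h z) = 0 := hy
    rwa [← hg', hgh] at this

/-- A direct summand inside the radical is fixed pointwise by its projection, hence zero; so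
approximating the radical by a summand leaves only the small part. -/
theorem isSmallSubmodule_jacobson_of_isProjectiveCover (hM : IsSemiperfectModule R M)
    {σ : P →ₗ[R] M} (hσ : IsProjectiveCover σ) : IsSmallSubmodule (Module.jacobson R P) := by
  obtain ⟨B, Q, hBQ, hB, hQ⟩ := exists_isCompl_le_of_ker_le hM hσ hσ.small_ker.le_jacobson
  have := hσ.projective
  have hB0 : B = ⊥ := by
    rw [eq_bot_iff]
    intro x hx
    refine eq_zero_of_apply_eq_self (B.subtype ∘ₗ B.projectionOnto Q hBQ) ?_ (x := x) ?_
    · rintro _ ⟨y, rfl⟩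
      exact hB (Subtype.prop _)
    · simpa using congrArg Subtype.val (Submodule.projectionOnto_apply_left hBQ ⟨x, hx⟩)
  have : Q = ⊤ := by simpa [hB0] using hBQ.sup_eq_top
  rwa [this, inf_top_eq] at hQ

theorem isSemisimpleModule_quotient_jacobson (hM : IsSemiperfectModule R M)
    {σ : P →ₗ[R] M} (hσ : IsProjectiveCover σ) :
    IsSemisimpleModule R (P ⧸ Module.jacobson R P) := by
  refine (isSemisimpleModule_iff _ _).mpr ⟨?_⟩
  set J := Module.jacobson R P
  intro X
  have hJ : J ≤ X.comap J.mkQ := by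
    conv_lhs => rw [← J.ker_mkQ]
    exact LinearMap.ker_le_comap _
  obtain ⟨B, Q, hBQ, hB, hQ⟩ := exists_isCompl_le_of_ker_le hM hσ
    (hσ.small_ker.le_jacobson.trans hJ)
  refine ⟨Q.map J.mkQ, ?_, ?_⟩
  · rw [Submodule.disjoint_def]
    rintro _ hx ⟨q, hq, rfl⟩
    rw [Submodule.mkQ_apply, Submodule.Quotient.mk_eq_zero]
    exact hQ.le_jacobson ⟨hx, hq⟩
  · rw [codisjoint_iff, eq_top_iff]
    intro y _
    obtain ⟨y, rfl⟩ := J.mkQ_surjective y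
    obtain ⟨b, hb, q, hq, rfl⟩ :=
      Submodule.mem_sup.mp (hBQ.sup_eq_top ▸ Submodule.mem_top : y ∈ B ⊔ Q)
    rw [map_add]
    exact Submodule.add_mem_sup (hB hb) ⟨q, hq, rfl⟩

end Projective

/-! ### Local submodules -/

section Local

variable {R : Type u} [Ring R] {M : Type v} [AddCommGroup M] [Module R M]
  {N : Type w} [AddCommGroup N] [Module R N]

/-- `X` need not lie in `B`, so a small submodule of the ambient module can be the witness. -/
theorem isLocalModule_iff {B : Submodule R M} :
    IsLocalModule R B ↔ ∃ X : Submodule R M, ¬ B ≤ X ∧ ∀ Z < B, Z ≤ X := by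
  constructor
  · rintro ⟨X, hX, h⟩
    refine ⟨X.map B.subtype, fun hB => hX ?_, fun Z hZ => ?_⟩
    · rw [eq_top_iff]
      intro x _
      obtain ⟨y, hy, hyx⟩ := hB x.2
      rwa [← Subtype.ext hyx]
    · intro z hz
      refine ⟨⟨z, hZ.le hz⟩, h (Z.comap B.subtype) (fun hZB => hZ.not_ge ?_) hz, rfl⟩
      rwa [Submodule.comap_subtype_eq_top] at hZB
  · rintro ⟨X, hX, h⟩
    refine ⟨X.comap B.subtype, by rwa [ne_eq, Submodule.comap_subtype_eq_top], fun Z hZ z hz => ?_⟩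
    refine h (Z.map B.subtype) (lt_of_le_of_ne (Submodule.map_subtype_le _ _) fun hZB => hZ ?_)
      ⟨z, hz, rfl⟩
    exact Submodule.map_injective_of_injective B.subtype_injective
      (hZB.trans (Submodule.map_subtype_top B).symm)

theorem IsLocalModule.map {B : Submodule R M} (hB : IsLocalModule R B) (f : M →ₗ[R] N)
    (h0 : B.map f ≠ ⊥) : IsLocalModule R (B.map f) := by
  obtain ⟨X, hX, h⟩ := isLocalModule_iff.mp hB
  have key : ∀ Z < B.map f, Z.comap f ⊓ B < B := by
    refine fun Z hZ => lt_of_le_of_ne inf_le_right fun he => hZ.not_ge ?_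
    rw [Submodule.map_le_iff_le_comap]
    exact inf_eq_right.mp he
  refine isLocalModule_iff.mpr ⟨(X ⊓ B).map f, fun hB' => hX ?_, fun Z hZ => ?_⟩
  · by_contra hX
    have hk : LinearMap.ker f ⊓ B ≤ X := by
      rw [← Submodule.comap_bot]
      exact h _ (key ⊥ (bot_lt_iff_ne_bot.mpr h0))
    apply hX
    intro b hb
    obtain ⟨x, ⟨hx, hxB⟩, hxb⟩ := hB' ⟨b, hb, rfl⟩
    have : b - x ∈ X := hk ⟨by simp [hxb], sub_mem hb hxB⟩
    simpa using add_mem this hx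
  · rintro z hz
    obtain ⟨b, hb, rfl⟩ := hZ.le hz
    exact ⟨b, ⟨h _ (key Z hZ) ⟨hz, hb⟩, hb⟩, rfl⟩

/-- If two submodules of a local module span it, one of them is the whole module. -/
theorem IsLocalModule.le_or_le_of_le_sup {B : Submodule R M} (hB : IsLocalModule R B)
    {Y Z : Submodule R M} (hY : Y ≤ B) (hZ : Z ≤ B) (h : B ≤ Y ⊔ Z) : B ≤ Y ∨ B ≤ Z := by
  obtain ⟨X, hX, hXB⟩ := isLocalModule_iff.mp hB
  by_contra! hc
  exact hX (h.trans (sup_le (hXB Y (lt_of_le_not_ge hY hc.1)) (hXB Z (lt_of_le_not_ge hZ hc.2))))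

end Local

/-! ### Decomposition of the cover into local summands -/

section Projective

variable {R : Type u} [Ring R] {M : Type v} [AddCommGroup M] [Module R M]
  {P : Type w} [AddCommGroup P] [Module R P]

/-- If `Z < B` is not inside `J`, it has the same image as `B`; smallness of `J` gives `Z + Q = P`,
and modularity gives `Z = B`, a contradiction. -/
theorem isLocalModule_of_isCompl {J B Q : Submodule R P} (hJ : IsSmallSubmodule J)
    (hBQ : IsCompl B Q) (h : IsAtom (B.map J.mkQ)) : IsLocalModule R B := by
  refine isLocalModule_iff.mpr ⟨J, fun hB => h.1 ?_, fun Z hZ => ?_⟩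
  · rwa [← LinearMap.le_ker_iff_map, Submodule.ker_mkQ]
  · rcases h.le_iff.mp (Submodule.map_mono (f := J.mkQ) hZ.le) with hZ0 | hZB
    · rwa [← LinearMap.le_ker_iff_map, Submodule.ker_mkQ] at hZ0
    · exfalso
      have h1 : B ≤ J ⊔ Z := by
        rw [← Submodule.comap_map_mkQ, hZB]
        exact Submodule.le_comap_map _ _
      have h2 : Z ⊔ Q = ⊤ := by
        apply hJ.eq_top
        rw [eq_top_iff, ← hBQ.sup_eq_top]
        exact sup_le (h1.trans (sup_le le_sup_right (le_sup_left.trans le_sup_left)))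
          (le_sup_right.trans le_sup_left)
      apply hZ.ne
      have h3 := sup_inf_assoc_of_le Q hZ.le
      rwa [h2, top_inf_eq, inf_comm, hBQ.inf_eq_bot, sup_bot_eq, eq_comm] at h3

/-- The sum map `φ` from the external direct sum splits. Independence modulo `J` puts its kernel in
the radical, and `1 - h ∘ φ` maps into that kernel and fixes it, so it vanishes. -/
theorem iSupIndep_of_iSupIndep_map_mkQ_jacobson [Module.Projective R P] {ι : Type*}
    {B Q : ι → Submodule R P} (hBQ : ∀ i, IsCompl (B i) (Q i)) (hB : ⨆ i, B i = ⊤)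
    (hind : iSupIndep fun i => (B i).map (Module.jacobson R P).mkQ) : iSupIndep B := by
  classical
  set J := Module.jacobson R P
  set φ := DFinsupp.lsum ℕ (fun i => (B i).subtype) with hφ
  have hφr : LinearMap.range φ = ⊤ := by
    rw [← hB, Submodule.iSup_eq_range_dfinsupp_lsum]
  obtain ⟨h, hh⟩ := φ.exists_rightInverse_of_surjective hφr
  have hφh : ∀ y, φ (h y) = y := fun y => LinearMap.congr_fun hh y
  have : ∀ i, Module.Projective R (B i) := fun i =>
    Module.Projective.of_split (B i).subtype ((B i).projectionOnto (Q i) (hBQ i)) (by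
      ext x; simp)
  let θ : ∀ i, B i →ₗ[R] (B i).map J.mkQ := fun i =>
    (J.mkQ ∘ₗ (B i).subtype).codRestrict _ fun x => ⟨x, x.2, rfl⟩
  have hθ : DFinsupp.lsum ℕ (fun i => ((B i).map J.mkQ).subtype) ∘ₗ DFinsupp.mapRange.linearMap θ
      = J.mkQ ∘ₗ φ := by
    refine DFinsupp.lhom_ext' fun i => LinearMap.ext fun x => ?_
    simp [θ, hφ]
    rfl
  have hker : LinearMap.ker φ ≤ Module.jacobson R (Π₀ i, B i) := by
    intro k hk
    have h1 : DFinsupp.mapRange.linearMap θ k = 0 := by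
      apply hind.dfinsupp_lsum_injective
      have := LinearMap.congr_fun hθ k
      rw [LinearMap.comp_apply, LinearMap.comp_apply, LinearMap.mem_ker.mp hk, map_zero] at this
      rw [map_zero]
      exact this
    have h2 : ∀ i, (k i : P) ∈ J := by
      intro i
      have : θ i (k i) = 0 := DFunLike.congr_fun h1 i
      exact (Submodule.Quotient.mk_eq_zero J).mp (congrArg Subtype.val this)
    rw [← DFinsupp.sum_single (f := k)]
    refine sum_mem fun i _ => ?_
    refine Module.map_jacobson_le 
      (DFinsupp.lsingle (M := fun i => B i) i ∘ₗ (B i).projectionOnto (Q i) (hBQ i))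
      ⟨k i, h2 i, ?_⟩
    simp
  apply iSupIndep_of_dfinsupp_lsum_injective
  rw [← LinearMap.ker_eq_bot, eq_bot_iff]
  intro k hk
  refine eq_zero_of_apply_eq_self (LinearMap.id - h ∘ₗ φ) ?_ (x := k) ?_
  · rintro _ ⟨y, rfl⟩
    apply hker
    simp [hφh]
  · have : φ k = 0 := hk
    simp [this]

/-- A projective cover of a semiperfect module is a direct sum of local modules. -/
theorem exists_iSupIndep_isLocalModule (hM : IsSemiperfectModule R M)
    {σ : P →ₗ[R] M} (hσ : IsProjectiveCover σ) :
    ∃ (ι : Type w) (B : ι → Submodule R P),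
      iSupIndep B ∧ ⨆ i, B i = ⊤ ∧ ∀ i, IsLocalModule R (B i) := by
  have := hσ.projective
  have hsmall := isSmallSubmodule_jacobson_of_isProjectiveCover hM hσ
  have hss := isSemisimpleModule_quotient_jacobson hM hσ
  set J := Module.jacobson R P
  obtain ⟨s, hs, hs', hsimple⟩ :=
    IsSemisimpleModule.exists_sSupIndep_sSup_simples_eq_top R (P ⧸ J)
  have hJ : ∀ U : Submodule R (P ⧸ J), J ≤ U.comap J.mkQ := fun U => by
    conv_lhs => rw [← J.ker_mkQ]
    exact LinearMap.ker_le_comap _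
  choose B Q hBQ hB hQ using fun U : s =>
    exists_isCompl_le_of_ker_le hM hσ (hσ.small_ker.le_jacobson.trans (hJ U))
  have hBU : ∀ U : s, (B U).map J.mkQ = U := by
    refine fun U => le_antisymm (Submodule.map_le_iff_le_comap.mpr (hB U)) fun y hy => ?_
    obtain ⟨y, rfl⟩ := J.mkQ_surjective y
    obtain ⟨b, hb, q, hq, rfl⟩ :=
      Submodule.mem_sup.mp ((hBQ U).sup_eq_top ▸ Submodule.mem_top : y ∈ B U ⊔ Q U)
    have hqU : q ∈ (U : Submodule R (P ⧸ J)).comap J.mkQ := by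
      rw [← add_sub_cancel_left b q]
      exact sub_mem (Submodule.mem_comap.mpr hy) (hB U hb)
    have hqJ : J.mkQ q = 0 :=
      (Submodule.Quotient.mk_eq_zero J).mpr ((hQ U).le_jacobson ⟨hqU, hq⟩)
    refine ⟨b, hb, ?_⟩
    rw [map_add, hqJ, add_zero]
  have htop : ⨆ U, B U = ⊤ := by
    apply hsmall.eq_top
    rw [sup_comm, ← Submodule.comap_map_mkQ, Submodule.map_iSup]
    simp_rw [hBU]
    rw [← sSup_eq_iSup', hs', Submodule.comap_top]
  refine ⟨s, B, iSupIndep_of_iSupIndep_map_mkQ_jacobson hBQ htop ?_, htop, fun U =>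
    isLocalModule_of_isCompl hsmall (hBQ U) ?_⟩
  · change iSupIndep fun U => (B U).map J.mkQ
    simp_rw [hBU]
    exact (sSupIndep_iff s).mp hs
  · rw [hBU, ← isSimpleModule_iff_isAtom]
    exact hsimple U U.2

end Projective

/-! ### Consequences of the ADS condition -/

section ADS

variable {R : Type u} [Ring R] {M : Type v} [AddCommGroup M] [Module R M]
  {P : Type w} [AddCommGroup P] [Module R P]

theorem exists_le_isComplementOf {S X : Submodule R M} (h : S ⊓ X = ⊥) :
    ∃ T, X ≤ T ∧ IsComplementOf T S := by
  refine zorn_le_nonempty₀ {X : Submodule R M | S ⊓ X = ⊥} (fun c hc hchain y hy => ?_) X h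
  refine ⟨sSup c, ?_, fun z hz => le_sSup hz⟩
  exact disjoint_iff.mp
    (hchain.directedOn.disjoint_sSup_right.mpr fun b hb => disjoint_iff.mpr (hc hb))

theorem IsADS.exists_isCompl_ge (hM : IsADS R M) {S T X : Submodule R M} (h : IsCompl S T)
    (hX : S ⊓ X = ⊥) : ∃ T', X ≤ T' ∧ IsCompl S T' := by
  obtain ⟨T', hXT', hT'⟩ := exists_le_isComplementOf hX
  exact ⟨T', hXT', hM S T T' h hT'⟩

/-- The ADS property of the subfactor `(S ⊔ T) / (S ⊓ T)`, stated inside `P`. -/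
theorem IsCompletelyADS.exists_inf_le_sup_ge (hP : IsCompletelyADS R P) {S T X : Submodule R P}
    (hX : S ⊓ T ≤ X) (hXN : X ≤ S ⊔ T) (hSX : S ⊓ X ≤ T) :
    ∃ T', X ≤ T' ∧ S ⊓ T' ≤ T ∧ S ⊔ T ≤ S ⊔ T' := by
  set N := S ⊔ T
  set K := (S ⊓ T).comap N.subtype
  -- For `Z` containing `S ⊓ T`, membership in `F Z` can be tested on any representative.
  let F : Submodule R P → Submodule R (N ⧸ K) := fun Z => (Z.comap N.subtype).map K.mkQ
  have hF : ∀ {Z : Submodule R P}, S ⊓ T ≤ Z → ∀ z : N, K.mkQ z ∈ F Z ↔ (z : P) ∈ Z := by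
    intro Z hZ z
    constructor
    · rintro ⟨y, hy, hyz⟩
      have : ((y - z : N) : P) ∈ S ⊓ T := (Submodule.Quotient.eq K).mp hyz
      rw [← sub_sub_cancel (y : P) z]
      exact sub_mem hy (hZ this)
    · exact fun hz => ⟨z, hz, rfl⟩
  have hcompl : IsCompl (F S) (F T) := by
    refine ⟨Submodule.disjoint_def.mpr fun y hyS hyT => ?_,
      codisjoint_iff.mpr (eq_top_iff.mpr fun y _ => ?_)⟩
    · obtain ⟨z, rfl⟩ := K.mkQ_surjective y
      exact (Submodule.Quotient.mk_eq_zero K).mpr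
        ⟨(hF inf_le_left z).mp hyS, (hF inf_le_right z).mp hyT⟩
    · obtain ⟨⟨z, hz⟩, rfl⟩ := K.mkQ_surjective y
      obtain ⟨s, hs, t, ht, rfl⟩ := Submodule.mem_sup.mp hz
      have hsN : s ∈ N := le_sup_left (a := S) hs
      have htN : t ∈ N := le_sup_right (a := S) ht
      exact Submodule.mem_sup.mpr ⟨K.mkQ ⟨s, hsN⟩, (hF inf_le_left _).mpr hs, K.mkQ ⟨t, htN⟩,
        (hF inf_le_right _).mpr ht, (map_add K.mkQ _ _).symm⟩
  have hdisj : F S ⊓ F X = ⊥ := by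
    rw [eq_bot_iff]
    rintro y ⟨hyS, hyX⟩
    obtain ⟨z, rfl⟩ := K.mkQ_surjective y
    have hzS := (hF inf_le_left z).mp hyS
    exact (Submodule.Quotient.mk_eq_zero K).mpr ⟨hzS, hSX ⟨hzS, (hF hX z).mp hyX⟩⟩
  obtain ⟨T', hXT', hT'⟩ := (hP N K).exists_isCompl_ge hcompl hdisj
  refine ⟨(T'.comap K.mkQ).map N.subtype, fun x hx => ?_, ?_, fun z hz => ?_⟩
  · exact ⟨⟨x, hXN hx⟩, hXT' ((hF hX _).mpr hx), rfl⟩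
  · rintro _ ⟨hzS, z, hzT', rfl⟩
    have : K.mkQ z = 0 :=
      Submodule.disjoint_def.mp hT'.disjoint _ ((hF inf_le_left z).mpr hzS) hzT'
    exact ((Submodule.Quotient.mk_eq_zero K).mp this : (z : P) ∈ S ⊓ T).2
  · obtain ⟨s', ⟨s, hs, rfl⟩, t', ht', hst⟩ := Submodule.mem_sup.mp
      (hT'.sup_eq_top ▸ Submodule.mem_top : K.mkQ ⟨z, hz⟩ ∈ F S ⊔ T')
    refine Submodule.mem_sup.mpr ⟨s, hs, z - s, ⟨⟨z, hz⟩ - s, ?_, rfl⟩, by simp⟩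
    rw [SetLike.mem_coe, Submodule.mem_comap, map_sub, ← hst, add_sub_cancel_left]
    exact ht'

theorem IsLocalModule.not_le_sup {K Q C : Submodule R P} (hQ : IsLocalModule R Q)
    (hK : IsSmallSubmodule K) (hQC : IsCompl Q C) : ¬ Q ≤ K ⊔ C := by
  intro h
  have hC : C = ⊤ := by
    apply hK.eq_top
    rw [eq_top_iff, ← hQC.sup_eq_top, sup_comm C]
    exact sup_le h le_sup_right
  have hQ0 : Q = ⊥ := by rw [← inf_top_eq Q, ← hC, hQC.inf_eq_bot]
  obtain ⟨X, hX, -⟩ := isLocalModule_iff.mp hQ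
  exact hX (hQ0 ▸ bot_le)

/-- In a completely ADS module, a small submodule is invariant under projections onto local direct
summands. -/
theorem IsCompletelyADS.mem_of_add_mem (hP : IsCompletelyADS R P) {K Q C : Submodule R P}
    (hK : IsSmallSubmodule K) (hQ : IsLocalModule R Q) (hQC : IsCompl Q C) {x y : P}
    (hx : x ∈ Q) (hy : y ∈ C) (hxy : x + y ∈ K) : x ∈ K := by
  have hQC0 : ∀ z ∈ Q, z ∈ C → z = 0 := Submodule.disjoint_def.mp hQC.disjoint
  -- `(Q ⊔ K) ⊓ C` is the projection of `K` to `C`. Modulo `S ⊓ T`, which lies in `K`, the submodule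
  -- `K` meets `S` trivially, so ADS yields a direct complement `T'` of `S` containing `K`.
  set S := ((Q ⊔ K) ⊓ C) ⊔ (K ⊓ Q)
  set T := Q ⊔ (K ⊓ C)
  have hST : S ⊓ T ≤ (K ⊓ Q) ⊔ (K ⊓ C) := by
    rintro _ ⟨hs, ht⟩
    obtain ⟨n, hn, a, ha, rfl⟩ := Submodule.mem_sup.mp hs
    obtain ⟨q, hq, b, hb, hqb⟩ := Submodule.mem_sup.mp ht
    have h1 : n - b = q - a := by rw [sub_eq_sub_iff_add_eq_add, hqb.symm]
    have h2 : n - b = 0 := hQC0 _ (h1 ▸ sub_mem hq ha.2) (sub_mem hn.2 hb.2)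
    rw [sub_eq_zero.mp h2, add_comm]
    exact Submodule.add_mem_sup ha hb
  have hKST : K ≤ S ⊔ T := by
    intro k hk
    obtain ⟨q, hq, c, hc, rfl⟩ :=
      Submodule.mem_sup.mp (hQC.sup_eq_top ▸ Submodule.mem_top : k ∈ Q ⊔ C)
    rw [add_comm]
    refine Submodule.add_mem_sup (Submodule.mem_sup_left ⟨?_, hc⟩) (Submodule.mem_sup_left hq)
    exact Submodule.mem_sup.mpr ⟨-q, neg_mem hq, _, hk, by simp⟩
  have hSK : S ⊓ K ≤ T := by
    rintro _ ⟨hs, hk⟩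
    obtain ⟨n, hn, a, ha, rfl⟩ := Submodule.mem_sup.mp hs
    rw [add_comm]
    refine Submodule.add_mem_sup ha.2 ⟨?_, hn.2⟩
    simpa using sub_mem hk ha.1
  obtain ⟨T', hKT', hST', hN⟩ :=
    hP.exists_inf_le_sup_ge (hST.trans (sup_le inf_le_left inf_le_left)) hKST hSK
  -- `Q` is covered by its intersections with `K ⊔ C` and `T'`; being local it lies in one of these,
  -- and smallness of `K` rules out the first.
  have hQT' : Q ≤ T' := by
    have hcov : Q ≤ ((K ⊔ C) ⊓ Q) ⊔ (T' ⊓ Q) := by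
      intro q hq
      obtain ⟨s, hs, t, ht, hst⟩ := Submodule.mem_sup.mp
        (hN (Submodule.mem_sup_right (Submodule.mem_sup_left hq)))
      obtain ⟨n, hn, a, ha, rfl⟩ := Submodule.mem_sup.mp hs
      obtain ⟨q', hq', k, hk, rfl⟩ := Submodule.mem_sup.mp hn.1
      refine Submodule.mem_sup.mpr ⟨q', ⟨?_, hq'⟩, q - q', ⟨?_, sub_mem hq hq'⟩, by simp⟩
      · exact Submodule.mem_sup.mpr ⟨-k, neg_mem hk, q' + k, hn.2, by simp⟩
      · have : q - q' = k + a + t := by rw [← hst]; abel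
        rw [this]
        exact add_mem (add_mem (hKT' hk) (hKT' ha.1)) ht
    rcases hQ.le_or_le_of_le_sup inf_le_right inf_le_right hcov with h | h
    · exact absurd (h.trans inf_le_left) (hQ.not_le_sup hK hQC)
    · exact h.trans inf_le_left
  have hyS : y ∈ S := by
    refine Submodule.mem_sup_left ⟨?_, hy⟩
    exact Submodule.mem_sup.mpr ⟨-x, neg_mem hx, _, hxy, by simp⟩
  have hyT' : y ∈ T' := by
    simpa using sub_mem (hKT' hxy) (hQT' hx)
  have hyK : y ∈ K := (hST.trans (sup_le inf_le_left inf_le_left)) ⟨hyS, hST' ⟨hyS, hyT'⟩⟩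
  simpa using sub_mem hxy hyK

theorem IsCompletelyADS.iSupIndep_map (hP : IsCompletelyADS R P) {σ : P →ₗ[R] M}
    (hσ : IsProjectiveCover σ) {ι : Type*} {B : ι → Submodule R P} (hB : iSupIndep B)
    (htop : ⨆ i, B i = ⊤) (hloc : ∀ i, IsLocalModule R (B i)) :
    iSupIndep fun i => (B i).map σ := by
  intro i
  simp only [← Submodule.map_iSup]
  rw [Submodule.disjoint_def]
  rintro _ ⟨x, hx, rfl⟩ ⟨y, hy, hxy⟩
  have hc : IsCompl (B i) (⨆ j, ⨆ (_ : j ≠ i), B j) := by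
    refine ⟨hB i, codisjoint_iff.mpr (eq_top_iff.mpr (htop ▸ iSup_le fun j => ?_))⟩
    rcases eq_or_ne j i with rfl | hj
    · exact le_sup_left
    · exact (le_iSup₂ (f := fun k (_ : k ≠ i) => B k) j hj).trans le_sup_right
  -- Equal images put `x - y` in the kernel, hence also its component `x`.
  exact hP.mem_of_add_mem hσ.small_ker (hloc i) hc hx (neg_mem hy) (by simp [hxy])

theorem isSupplementOf_of_isCompl {X A : Submodule R M} (h : IsCompl X A) :
    IsSupplementOf X A := by
  refine ⟨h.symm.sup_eq_top, fun Y hY hYX => ?_⟩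
  have := sup_inf_assoc_of_le A hYX
  rw [sup_comm Y, show A ⊔ Y = ⊤ from hY, top_inf_eq, h.symm.inf_eq_bot, sup_bot_eq] at this
  exact this.le

theorem isLocalModule_map_of_isCompl {σ : P →ₗ[R] M} (hσ : IsSmallSubmodule (LinearMap.ker σ))
    {Q C : Submodule R P} (hQ : IsLocalModule R Q) (hQC : IsCompl Q C) :
    IsLocalModule R (Q.map σ) := by
  exact hQ.map σ fun h0 => hQ.not_le_sup hσ hQC
    ((LinearMap.le_ker_iff_map.mpr h0).trans le_sup_left)

end ADS

/-! ### Regrouping the terms and finding supplements -/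

section Decomposition

variable {R : Type u} [Ring R] {M : Type v} [AddCommGroup M] [Module R M]

/-- `c` sends each piece to the term absorbing it, turning partial sums of terms into partial sums
of pieces. -/
theorem biSup_terms_eq {ι κ : Type*} {S : Submodule R M} {L : ι → Submodule R M}
    {D : κ → Submodule R M} (c : κ → Option ι) (hS : S = ⨆ d ∈ c ⁻¹' {none}, D d)
    (hL : ∀ i, L i = ⨆ d ∈ c ⁻¹' {some i}, D d) (A : Set (Option ι)) :
    ⨆ o ∈ A, terms S L o = ⨆ d ∈ c ⁻¹' A, D d := by
  have h : ∀ o, terms S L o = ⨆ d ∈ c ⁻¹' {o}, D d := by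
    rintro (_ | i)
    exacts [hS, hL i]
  simp_rw [h]
  refine le_antisymm (iSup₂_le fun o ho => iSup₂_le fun d hd => ?_) (iSup₂_le fun d hd => ?_)
  · exact le_biSup D (show c d ∈ A from (show c d = o from hd) ▸ ho)
  · exact (le_biSup D (show d ∈ c ⁻¹' {c d} from rfl)).trans
      (le_biSup (fun o => ⨆ d ∈ c ⁻¹' {o}, D d) hd)

theorem isCompl_biSup_compl {κ : Type*} {D : κ → Submodule R M} (hD : iSupIndep D)
    (htop : ⨆ d, D d = ⊤) (A : Set κ) : IsCompl (⨆ d ∈ A, D d) (⨆ d ∈ Aᶜ, D d) := by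
  refine ⟨hD.disjoint_biSup_biSup disjoint_compl_right, codisjoint_iff.mpr (eq_top_iff.mpr ?_)⟩
  rw [← htop]
  refine iSup_le fun d => ?_
  by_cases hd : d ∈ A
  · exact (le_biSup D hd).trans le_sup_left
  · exact (le_biSup D (show d ∈ Aᶜ from hd)).trans le_sup_right

/-- Collecting the simple terms of a decomposition into local submodules. -/
theorem exists_semisimple_sup_local (D : Set (Submodule R M)) (hD : sSupIndep D)
    (htop : sSup D = ⊤) (hloc : ∀ d ∈ D, IsLocalModule R d) :
    ∃ (S T : Submodule R M) (ι : Type v) (L : ι → Submodule R M),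
      IsCompl S T ∧
      IsSemisimpleModule R S ∧
      (iSupIndep L ∧ (⨆ i, L i) = T ∧ ∀ i, IsLocalModule R (L i)) ∧
      ∀ A : Set (Option ι), ∃ X : Submodule R M,
        X ≤ (⨆ o ∈ A, terms S L o) ∧ IsSupplementOf X (⨆ o ∈ Aᶜ, terms S L o) := by
  classical
  rw [sSupIndep_iff] at hD
  rw [sSup_eq_iSup'] at htop
  let simples : Set D := {d | IsSimpleModule R d.1}
  let L : ↥simplesᶜ → Submodule R M := fun d => d.1.1
  let c : D → Option ↥simplesᶜ := fun d => if h : d ∈ simples then none else some ⟨d, h⟩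
  have hnone : c ⁻¹' {none} = simples := by
    ext d
    by_cases h : d ∈ simples <;> simp [c, h]
  have hsome : ∀ i, c ⁻¹' {some i} = {i.1} := by
    intro i
    ext d
    by_cases h : d ∈ simples
    · simp only [c, h, dite_true, Set.mem_preimage, Set.mem_singleton_iff, reduceCtorEq, false_iff]
      rintro rfl
      exact i.2 h
    · simp [c, h, Subtype.ext_iff]
  refine ⟨⨆ d ∈ simples, d.1, ⨆ d ∈ simplesᶜ, d.1, ↥simplesᶜ, L,
    isCompl_biSup_compl hD htop simples, ?_, ⟨?_, ?_, ?_⟩, fun A => ?_⟩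
  · refine isSemisimpleModule_biSup_of_isSemisimpleModule_submodule fun d hd => ?_
    have : IsSimpleModule R d.1 := hd
    infer_instance
  · exact hD.comp Subtype.val_injective
  · exact le_antisymm (iSup_le fun i => le_biSup (fun d : D => d.1) i.2)
      (iSup₂_le fun d hd => le_iSup L ⟨d, hd⟩)
  · exact fun i => hloc _ i.1.2
  · refine ⟨_, le_rfl, isSupplementOf_of_isCompl ?_⟩
    have h := biSup_terms_eq (S := ⨆ d ∈ simples, d.1) (L := L) (D := fun d : D => d.1) c
      (by rw [hnone]) (fun i => by rw [hsome, iSup_singleton])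
    rw [h, h, Set.preimage_compl]
    exact isCompl_biSup_compl hD htop _

end Decomposition

end ADSModule

theorem mainTheorem2 {R : Type u} [Ring R]
    {M : Type v} [AddCommGroup M] [Module R M]
    {P : Type w} [AddCommGroup P] [Module R P]
    (hM : ADSModule.IsSemiperfectModule R M)
    (σ : P →ₗ[R] M) (hσ : ADSModule.IsProjectiveCover σ)
    (hP : ADSModule.IsCompletelyADS R P) :
    ∃ (S T : Submodule R M) (ι : Type v) (L : ι → Submodule R M),
      IsCompl S T ∧
      IsSemisimpleModule R S ∧
      (iSupIndep L ∧ (⨆ i, L i) = T ∧ ∀ i, ADSModule.IsLocalModule R (L i)) ∧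
      ∀ A : Set (Option ι), ∃ X : Submodule R M,
        X ≤ (⨆ o ∈ A, ADSModule.terms S L o) ∧
        ADSModule.IsSupplementOf X (⨆ o ∈ Aᶜ, ADSModule.terms S L o) := by
  obtain ⟨κ, B, hB, htop, hloc⟩ := ADSModule.exists_iSupIndep_isLocalModule hM hσ
  have hcompl : ∀ i, IsCompl (B i) (⨆ j ∈ ({i} : Set κ)ᶜ, B j) := fun i => by
    simpa only [iSup_singleton] using ADSModule.isCompl_biSup_compl hB htop {i}
  -- Passing to the set of images replaces the index type `κ : Type w` by one in `Type v`.
  refine ADSModule.exists_semisimple_sup_local (Set.range fun i => (B i).map σ)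
    (hP.iSupIndep_map hσ hB htop hloc).sSupIndep_range ?_ ?_
  · rw [sSup_range, ← Submodule.map_iSup, htop, Submodule.map_top]
    exact LinearMap.range_eq_top.mpr hσ.surjective
  · rintro _ ⟨i, rfl⟩
    exact ADSModule.isLocalModule_map_of_isCompl hσ.small_ker (hloc i) (hcompl i)
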